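/- Caching in Matchings. Let $2\le k<n$, and let $V^{in},V^{out}$ be two sets of $n$ nodes each. A cache consists of $k$ matchings of the complete bipartite graph between $V^{in}$ and $V^{out}$; initially all of them are empty. A sequence of edges $\sigma=(e_1,\dots,e_T)$ of $V^{in}\times V^{out}$ is requested one edge at a time, and after the $t$-th request the edge $e_t$ must belong to (at least) one of the $k$ matchings of the cache. At each step any edges may be evicted from the matchings at no cost and any edges may be inserted, as long as every one of the $k$ sets remains a matching; every insertion of an edge into a matching costs $1$ (in particular, transferring an edge from one matching to another costs $1$). A deterministic online algorithm $A$ determines the cache after the $t$-th request as a function of $e_1,\dots,e_t$ only. Let $cost(A(\sigma))$ be its total cost on $\sigma$, and let $cost(OPT(\sigma))$ be the minimum total cost of serving $\sigma$ when the whole sequence is known in advance. For given $n$ and $k$, the algorithm is called $c$-competitive if there is a number $d$, independent of $\sigma$, such that $cost(A(\sigma))\le c\cdot cost(OPT(\sigma))+d$ for every finite request sequence $\sigma$. Theorem. The competitive ratio of every deterministic online algorithm for Caching in Matchings is $\Omega(n/k)$: there is an absolute constant $\alpha>0$ such that for all integers $n,k$ with $2\le k<n$, every deterministic online algorithm $A$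 for Caching in Matchings with parameters $n,k$, and every real $c$, if $A$ is $c$-competitive, then $c\ge\alpha\cdot\frac nk$. -/

import Mathlib

namespace CachingInMatchings

/-- A connection between an input port and an output port: an edge of the complete bipartite
graph with `n` nodes on each side. -/
abbrev Edge (n : ℕ) : Type := Fin n × Fin n

/-- A set of edges of the bipartite graph is a matching if no two distinct edges of it share an
endpoint. -/
def IsMatching {n : ℕ} (m : Finset (Edge n)) : Prop :=
  ∀ e ∈ m, ∀ f ∈ m, e.1 = f.1 ∨ e.2 = f.2 → e = f

/-- A cache configuration: `k` matchings. -/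
structure Cache (n k : ℕ) where
  matching : Fin k → Finset (Edge n)
  isMatching : ∀ j, IsMatching (matching j)

/-- The edge `e` is cached in one of the `k` matchings. -/
def Cache.Contains {n k : ℕ} (M : Cache n k) (e : Edge n) : Prop :=
  ∃ j, e ∈ M.matching j

/-- The empty cache. -/
def Cache.empty (n k : ℕ) : Cache n k where
  matching := fun _ => ∅
  isMatching := by intro j e he; simp at he

/-- The cost of changing the cache from `M` to `M'`: every insertion of an edge into a matching
costs `1`, evictions are free. An edge that goes from one matching to another is evicted and
fetched again, so it costs `1`. -/
def Cache.switchCost {n k : ℕ} (M M' : Cache n k) : ℕ :=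
  ∑ j, (M'.matching j \ M.matching j).card

/-- `S` is a way to serve the request sequence `σ`: the cache is empty at first, `S (i + 1)` is
the cache with which the request `σ[i]` is served, and it must contain the requested edge. -/
structure IsSchedule {n k : ℕ} (σ : List (Edge n)) (S : ℕ → Cache n k) : Prop where
  start : S 0 = Cache.empty n k
  serves : ∀ (i : ℕ) (h : i < σ.length), (S (i + 1)).Contains σ[i]

/-- The total cost of the first `T` cache changes. -/
def scheduleCost {n k : ℕ} (S : ℕ → Cache n k) (T : ℕ) : ℕ :=
  ∑ i ∈ Finset.range T, (S i).switchCost (S (i + 1))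

/-- The cost of an optimal offline solution for `σ` with `k` matchings. -/
noncomputable def optCost {n : ℕ} (k : ℕ) (σ : List (Edge n)) : ℕ :=
  sInf {m : ℕ | ∃ S : ℕ → Cache n k, IsSchedule σ S ∧ scheduleCost S σ.length = m}

/-- A deterministic online algorithm: the cache after each request is a function of the requests
up to and including that one, and it contains the edge that was just requested. -/
structure OnlineAlgorithm (n k : ℕ) where
  state : List (Edge n) → Cache n k
  start : state [] = Cache.empty n k
  serves : ∀ (σ : List (Edge n)) (e : Edge n), (state (σ ++ [e])).Contains e

/-- The sequence of caches of the algorithm while it processes `σ`. -/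
def OnlineAlgorithm.run {n k : ℕ} (A : OnlineAlgorithm n k) (σ : List (Edge n)) :
    ℕ → Cache n k :=
  fun i => A.state (σ.take i)

/-- The cost of the algorithm on `σ`. -/
def OnlineAlgorithm.cost {n k : ℕ} (A : OnlineAlgorithm n k) (σ : List (Edge n)) : ℕ :=
  scheduleCost (A.run σ) σ.length

/-- The algorithm is `c`-competitive: up to an additive constant `d`, which does not depend on the
request sequence, its cost is at most `c` times the optimal offline cost. -/
def OnlineAlgorithm.IsCompetitive {n k : ℕ} (A : OnlineAlgorithm n k) (c : ℝ) : Prop :=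
  ∃ d : ℝ, ∀ σ : List (Edge n), (A.cost σ : ℝ) ≤ c * (optCost k σ : ℝ) + d

/-- The run of an online algorithm is one of the offline solutions, so the infimum in `optCost`
is over a nonempty set whenever an online algorithm exists. -/
theorem OnlineAlgorithm.isSchedule_run {n k : ℕ} (A : OnlineAlgorithm n k) (σ : List (Edge n)) :
    IsSchedule σ (A.run σ) where
  start := by simpa [OnlineAlgorithm.run] using A.start
  serves := by
    intro i h
    have h1 := A.serves (σ.take i) σ[i]
    rwa [List.take_concat_get' σ i h] at h1

end CachingInMatchings

namespace CachingInMatchings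

/-! ### Switching costs between caches. -/

variable {n k : ℕ}

/-! Two graphs differ in a single bridge, but holding one of them completely and then the other
forces many insertions. If all edges at the `k` ingoing nodes of a block are cached, each such node
has one edge in every matching. As the edge between the two nodes `(j, 0)` is absent, the bridges
entering and leaving the block must then share a matching (`Cache.mem_matching_of_block`). So one
colour propagates along a chain. In `graph n k m false` the `2 * m` blocks form one chain of one
colour; in `graph n k m true` both chains end at the same node, so their colours differ. Passing
between the graphs therefore recolours the `m - 1` inner bridges of one chain.

Leaving out one bridge removes the rigidity: for each of the `m` blocks `i` of the second chain,
`chainCache` changes colour at the omitted bridge and can be adapted to the other graph by one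
insertion.

The adversary (`exists_adversary`) always requests an edge the algorithm lacks, so every request
costs it at least `1`. Averaging over the `m` offline strategies, a request costs at most `3 / m`,
since only one strategy can miss it, and a change of graph costs `1`, against at least `m - 1`
online for every change after the first. Hence OPT is at most `5 / m` times the online cost plus a
constant, and `m` is of order `n / k`. For small `m` the bound `1 ≤ c` suffices. -/

theorem Cache.switchCost_self (M : Cache n k) : M.switchCost M = 0 := by
  simp [Cache.switchCost]

theorem Cache.switchCost_triangle (M₁ M₂ M₃ : Cache n k) :
    M₁.switchCost M₃ ≤ M₁.switchCost M₂ + M₂.switchCost M₃ := by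
  unfold Cache.switchCost
  rw [← Finset.sum_add_distrib]
  refine Finset.sum_le_sum fun j _ => ?_
  refine (Finset.card_le_card (t := (M₂.matching j \ M₁.matching j) ∪
    (M₃.matching j \ M₂.matching j)) ?_).trans (Finset.card_union_le _ _)
  intro e he
  simp only [Finset.mem_union, Finset.mem_sdiff] at he ⊢
  tauto

theorem Cache.card_le_switchCost {M M' : Cache n k} {j : Fin k} {F : Finset (Edge n)}
    (h' : ∀ e ∈ F, e ∈ M'.matching j) (h : ∀ e ∈ F, e ∉ M.matching j) :
    F.card ≤ M.switchCost M' := by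
  refine (Finset.card_le_card (t := M'.matching j \ M.matching j) ?_).trans
    (Finset.single_le_sum (f := fun j => (M'.matching j \ M.matching j).card)
      (fun _ _ => Nat.zero_le _) (Finset.mem_univ j))
  intro e he
  exact Finset.mem_sdiff.2 ⟨h' e he, h e he⟩

theorem Cache.one_le_switchCost {M M' : Cache n k} {e : Edge n}
    (h : ¬ M.Contains e) (h' : M'.Contains e) : 1 ≤ M.switchCost M' := by
  obtain ⟨j, hj⟩ := h'
  have := Cache.card_le_switchCost (M := M) (M' := M') (j := j) (F := {e})
    (by simpa using hj) (by simpa using fun hm => h ⟨j, hm⟩)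
  simpa using this

theorem Cache.switchCost_le {M M' : Cache n k} (j : Fin k) (F : Finset (Edge n))
    (hj : M'.matching j \ M.matching j ⊆ F)
    (h : ∀ i, i ≠ j → M'.matching i ⊆ M.matching i) : M.switchCost M' ≤ F.card := by
  unfold Cache.switchCost
  rw [Finset.sum_eq_single j]
  · exact Finset.card_le_card hj
  · intro i _ hi
    simpa [Finset.sdiff_eq_empty_iff_subset] using h i hi
  · simp

/-- Any edge can be brought into a cache at cost `1` in such a way that the old cache can be
restored at cost at most `2`. -/
theorem Cache.exists_serve (M : Cache n k) (hk : 0 < k) (e : Edge n) :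
    ∃ M' : Cache n k, M'.Contains e ∧ M.switchCost M' ≤ 1 ∧ M'.switchCost M ≤ 2 := by
  classical
  let j : Fin k := ⟨0, hk⟩
  let N : Finset (Edge n) :=
    insert e ((M.matching j).filter fun f => f.1 ≠ e.1 ∧ f.2 ≠ e.2)
  have hN : IsMatching N := by
    intro a ha b hb hab
    have hM := M.isMatching j
    simp only [N, Finset.mem_insert, Finset.mem_filter] at ha hb
    rcases ha with rfl | ⟨ha, ha'⟩ <;> rcases hb with rfl | ⟨hb, hb'⟩
    · rfl
    · exact absurd hab (by rintro (h | h); exacts [hb'.1 h.symm, hb'.2 h.symm])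
    · exact absurd hab (by rintro (h | h); exacts [ha'.1 h, ha'.2 h])
    · exact hM a ha b hb hab
  let M' : Cache n k :=
    { matching := Function.update M.matching j N
      isMatching := by
        intro i
        by_cases hi : i = j
        · subst hi; simpa using hN
        · simpa [Function.update_of_ne hi] using M.isMatching i }
  have hj : M'.matching j = N := by simp [M']
  have hi : ∀ i, i ≠ j → M'.matching i = M.matching i := fun i h => by
    simp [M', Function.update_of_ne h]
  refine ⟨M', ⟨j, by simp [hj, N]⟩, ?_, ?_⟩
  · refine (Cache.switchCost_le j {e} ?_ fun i h => (hi i h).le).trans (by simp)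
    intro a ha
    simp only [hj, N, Finset.mem_sdiff, Finset.mem_insert, Finset.mem_filter] at ha
    simp only [Finset.mem_singleton]
    tauto
  · refine (Cache.switchCost_le j ((M.matching j).filter (fun f => f.1 = e.1) ∪
      (M.matching j).filter (fun f => f.2 = e.2)) ?_ fun i h => (hi i h).ge).trans
      ((Finset.card_union_le _ _).trans ?_)
    · intro a ha
      simp only [hj, N, Finset.mem_sdiff, Finset.mem_insert, Finset.mem_filter] at ha
      simp only [Finset.mem_union, Finset.mem_filter]
      tauto
    · have h1 : ((M.matching j).filter (fun f => f.1 = e.1)).card ≤ 1 := by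
        refine Finset.card_le_one.2 fun a ha b hb => ?_
        simp only [Finset.mem_filter] at ha hb
        exact M.isMatching j a ha.1 b hb.1 (Or.inl (ha.2.trans hb.2.symm))
      have h2 : ((M.matching j).filter (fun f => f.2 = e.2)).card ≤ 1 := by
        refine Finset.card_le_one.2 fun a ha b hb => ?_
        simp only [Finset.mem_filter] at ha hb
        exact M.isMatching j a ha.1 b hb.1 (Or.inr (ha.2.trans hb.2.symm))
      omega

/-! ### Building schedules request by request. -/

/-- The requests `σ` can be served with total cost `C`, ending with the cache `M`. -/
def Serves (σ : List (Edge n)) (M : Cache n k) (C : ℕ) : Prop :=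
  ∃ S : ℕ → Cache n k, IsSchedule σ S ∧ S σ.length = M ∧ scheduleCost S σ.length = C

theorem Serves.nil : Serves ([] : List (Edge n)) (Cache.empty n k) 0 :=
  ⟨fun _ => Cache.empty n k, ⟨rfl, fun i h => absurd h (by simp)⟩, rfl, by simp [scheduleCost]⟩

theorem Serves.concat {σ : List (Edge n)} {M M' : Cache n k} {C : ℕ} {e : Edge n}
    (h : Serves σ M C) (he : M'.Contains e) : Serves (σ ++ [e]) M' (C + M.switchCost M') := by
  obtain ⟨S, hS, hM, hC⟩ := h
  have hS' : ∀ i ≤ σ.length, Function.update S (σ.length + 1) M' i = S i := fun i hi =>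
    Function.update_of_ne (by omega) _ _
  refine ⟨Function.update S (σ.length + 1) M', ⟨?_, ?_⟩, ?_, ?_⟩
  · rw [hS' 0 (Nat.zero_le _), hS.start]
  · intro i hi
    rw [List.length_append, List.length_singleton] at hi
    rcases Nat.lt_succ_iff_lt_or_eq.1 hi with h | rfl
    · rw [hS' _ h, List.getElem_append_left h]
      exact hS.serves i h
    · simpa using he
  · simp
  · rw [List.length_append, List.length_singleton, scheduleCost, Finset.sum_range_succ,
      hS' _ le_rfl, hM, Function.update_self, ← hC, scheduleCost]
    congr 1
    refine Finset.sum_congr rfl fun i hi => ?_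
    rw [Finset.mem_range] at hi
    rw [hS' _ hi.le, hS' _ hi]

theorem Serves.optCost_le {σ : List (Edge n)} {M : Cache n k} {C : ℕ} (h : Serves σ M C) :
    optCost k σ ≤ C := by
  obtain ⟨S, hS, -, hC⟩ := h
  exact Nat.sInf_le ⟨S, hS, hC⟩

namespace OnlineAlgorithm

theorem optCost_le_cost (A : OnlineAlgorithm n k) (σ : List (Edge n)) :
    optCost k σ ≤ A.cost σ :=
  Nat.sInf_le ⟨A.run σ, A.isSchedule_run σ, rfl⟩

theorem cost_concat (A : OnlineAlgorithm n k) (σ : List (Edge n)) (e : Edge n) :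
    A.cost (σ ++ [e]) = A.cost σ + (A.state σ).switchCost (A.state (σ ++ [e])) := by
  unfold cost scheduleCost run
  rw [List.length_append, List.length_singleton, Finset.sum_range_succ]
  congr 1
  · refine Finset.sum_congr rfl fun i hi => ?_
    rw [Finset.mem_range] at hi
    rw [List.take_append_of_le_length hi.le, List.take_append_of_le_length hi]
  · rw [List.take_left, List.take_of_length_le (by simp)]

theorem cost_concat_of_not_contains (A : OnlineAlgorithm n k) {σ : List (Edge n)} {e : Edge n}
    (h : ¬ (A.state σ).Contains e) : A.cost σ + 1 ≤ A.cost (σ ++ [e]) := by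
  rw [cost_concat]
  have := Cache.one_le_switchCost h (A.serves σ e)
  omega

end OnlineAlgorithm

/-! ### Unbounded online cost and the criterion for the ratio. -/

theorem IsMatching.card_le {m : Finset (Edge n)} (h : IsMatching m) : m.card ≤ n := by
  have := Finset.card_le_card_of_injOn (s := m) (t := Finset.univ) (fun e => e.1)
    (by simp) (fun a ha b hb hab => h a ha b hb (Or.inl hab))
  simpa using this

/-- By counting: `k` matchings hold at most `k * n < n * n` edges. -/
theorem Cache.exists_not_contains (hkn : k < n) (M : Cache n k) : ∃ e, ¬ M.Contains e := by
  classical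
  by_contra! h
  have h1 : (Finset.univ : Finset (Edge n)) ⊆ Finset.univ.biUnion M.matching := by
    intro e _
    obtain ⟨j, hj⟩ := h e
    exact Finset.mem_biUnion.2 ⟨j, Finset.mem_univ _, hj⟩
  have h2 := (Finset.card_le_card h1).trans
    (Finset.card_biUnion_le_card_mul _ _ n fun j _ => (M.isMatching j).card_le)
  simp only [Finset.card_univ, Fintype.card_prod, Fintype.card_fin] at h2
  have := Nat.le_of_mul_le_mul_right h2 (by omega)
  omega

namespace OnlineAlgorithm

theorem exists_le_cost (A : OnlineAlgorithm n k) (hkn : k < n) (T : ℕ) :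
    ∃ σ : List (Edge n), T ≤ A.cost σ := by
  induction T with
  | zero => exact ⟨[], Nat.zero_le _⟩
  | succ T ih =>
    obtain ⟨σ, hσ⟩ := ih
    obtain ⟨e, he⟩ := (A.state σ).exists_not_contains hkn
    exact ⟨σ ++ [e], (Nat.succ_le_succ hσ).trans (A.cost_concat_of_not_contains he)⟩

/-- If arbitrarily expensive sequences have an offline cost of at most `q` times the online cost,
up to a constant, then the competitive ratio is at least `1 / q`. -/
theorem IsCompetitive.one_le_mul {A : OnlineAlgorithm n k} {c q K : ℝ} (hc : A.IsCompetitive c)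
    (h : ∀ T : ℕ, ∃ σ : List (Edge n), T ≤ A.cost σ ∧
      (optCost k σ : ℝ) ≤ q * A.cost σ + K) : 1 ≤ c * q := by
  obtain ⟨d, hd⟩ := hc
  -- A negative `c` would bound the online cost by `d`, although it is unbounded.
  have hc0 : 0 ≤ c := by
    by_contra! hc0
    obtain ⟨T, hT⟩ := exists_nat_gt d
    obtain ⟨σ, hσ, -⟩ := h T
    have h1 := hd σ
    have h2 : (T : ℝ) ≤ A.cost σ := by exact_mod_cast hσ
    have h3 : c * (optCost k σ : ℝ) ≤ 0 :=
      mul_nonpos_of_nonpos_of_nonneg hc0.le (Nat.cast_nonneg _)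
    linarith
  by_contra! hlt
  obtain ⟨T, hT⟩ := exists_nat_gt ((c * K + d) / (1 - c * q))
  obtain ⟨σ, hσ, hopt⟩ := h T
  have h1 := hd σ
  have h2 : (T : ℝ) ≤ A.cost σ := by exact_mod_cast hσ
  have h3 := mul_le_mul_of_nonneg_left hopt hc0
  rw [div_lt_iff₀ (by linarith)] at hT
  have h4 := mul_le_mul_of_nonneg_right h2 (by linarith : 0 ≤ 1 - c * q)
  nlinarith

theorem IsCompetitive.one_le {A : OnlineAlgorithm n k} {c : ℝ} (hc : A.IsCompetitive c)
    (hkn : k < n) : 1 ≤ c := by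
  have := hc.one_le_mul (q := 1) (K := 0) fun T => by
    obtain ⟨σ, hσ⟩ := A.exists_le_cost hkn T
    refine ⟨σ, hσ, ?_⟩
    simpa using A.optCost_le_cost σ
  simpa using this

/-! ### The adversary and the averaging argument. -/

/-- The adversary requests a missing edge of one of two graphs, and changes to the other graph as
soon as the algorithm caches all of the current one. If this change costs the algorithm at least
`w`, while each of the offline caches `D i` can be adapted to it at cost `1`, and every requested
edge is missing in at most one of them, then the offline caches are cheap on average. -/
theorem exists_adversary {ι : Type*} [Fintype ι] (A : OnlineAlgorithm n k) (hk : 0 < k)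
    (G : Bool → Set (Edge n)) (D : ι → Bool → Cache n k) {w : ℕ} (hw : 0 < w)
    (hG : ∀ (b : Bool) (M M' : Cache n k), (∀ e ∈ G b, M.Contains e) →
      (∀ e ∈ G (!b), M'.Contains e) → w ≤ M.switchCost M')
    (hD : ∀ i b, (D i b).switchCost (D i (!b)) ≤ 1)
    (hmiss : ∀ b, ∀ e ∈ G b, ∀ i j, ¬ (D i b).Contains e → ¬ (D j b).Contains e → i = j) (T : ℕ) :
    ∃ σ : List (Edge n), T ≤ A.cost σ ∧ w * (Fintype.card ι * optCost k σ) ≤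
      w * ∑ i, (Cache.empty n k).switchCost (D i false) + Fintype.card ι * w +
        (Fintype.card ι + 3 * w) * A.cost σ := by
  classical
  -- Invariant: `b` is the current graph, `P` counts the changes of graph, `hits i` the requests
  -- missing in `D i`. The cache `M` in the third clause is the online cache at the last change; the
  -- slack `w` covers the first change, which need not cost the algorithm anything. In the last
  -- clause the cost of returning to `D i b` is already reserved.
  suffices H : ∃ (σ : List (Edge n)) (b : Bool) (P : ℕ) (hits : ι → ℕ), T ≤ A.cost σ ∧
      ∑ i, hits i ≤ A.cost σ ∧
      (P = 0 ∨ ∃ M : Cache n k, (∀ e ∈ G (!b), M.Contains e) ∧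
        w * P + M.switchCost (A.state σ) ≤ A.cost σ + w) ∧
      ∀ i, ∃ (M : Cache n k) (C : ℕ), Serves σ M C ∧ C + M.switchCost (D i b) ≤
        (Cache.empty n k).switchCost (D i false) + P + 3 * hits i by
    obtain ⟨σ, b, P, hits, hT, hhits, hP, hoff⟩ := H
    refine ⟨σ, hT, ?_⟩
    have h1 : Fintype.card ι * optCost k σ ≤
        ∑ i, ((Cache.empty n k).switchCost (D i false) + P + 3 * hits i) := by
      rw [← smul_eq_mul, ← Finset.card_univ, ← Finset.sum_const]
      refine Finset.sum_le_sum fun i _ => ?_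
      obtain ⟨M, C, hS, hC⟩ := hoff i
      exact hS.optCost_le.trans ((Nat.le_add_right _ _).trans hC)
    rw [Finset.sum_add_distrib, Finset.sum_add_distrib, Finset.sum_const, ← Finset.mul_sum,
      Finset.card_univ, smul_eq_mul] at h1
    have h2 : w * P ≤ A.cost σ + w := by
      rcases hP with rfl | ⟨M, -, h⟩
      · simp
      · omega
    have h3 := Nat.mul_le_mul_left w h1
    have h4 := Nat.mul_le_mul_left (Fintype.card ι) h2
    have h5 := Nat.mul_le_mul_left w hhits
    linarith
  induction T with
  | zero =>
    refine ⟨[], false, 0, fun _ => 0, Nat.zero_le _, by simp, Or.inl rfl, fun i => ?_⟩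
    exact ⟨_, _, Serves.nil, by simp⟩
  | succ T ih =>
    obtain ⟨σ, b, P, hits, hT, hhits, hP, hoff⟩ := ih
    obtain ⟨b', P', e, heG, heA, hP', hoff'⟩ : ∃ (b' : Bool) (P' : ℕ) (e : Edge n),
        e ∈ G b' ∧ ¬ (A.state σ).Contains e ∧
        (P' = 0 ∨ ∃ M : Cache n k, (∀ e ∈ G (!b'), M.Contains e) ∧
          w * P' + M.switchCost (A.state σ) ≤ A.cost σ + w) ∧
        ∀ i, ∃ (M : Cache n k) (C : ℕ), Serves σ M C ∧ C + M.switchCost (D i b') ≤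
          (Cache.empty n k).switchCost (D i false) + P' + 3 * hits i := by
      by_cases hfull : ∀ e ∈ G b, (A.state σ).Contains e
      -- A cache holding both graphs would contradict `hG` with `M = M'`, as staying put costs `0 <
      -- w`.
      · have : ∃ e ∈ G (!b), ¬ (A.state σ).Contains e := by
          by_contra! h
          have := hG b _ _ hfull h
          rw [Cache.switchCost_self] at this
          omega
        obtain ⟨e, he, heA⟩ := this
        refine ⟨!b, P + 1, e, he, heA, Or.inr ⟨A.state σ, by simpa using hfull, ?_⟩, ?_⟩
        · rw [Cache.switchCost_self, Nat.mul_succ]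
          rcases hP with rfl | ⟨M, hM, h⟩
          · simp
          · have := hG (!b) M (A.state σ) hM (by simpa using hfull)
            omega
        · intro i
          obtain ⟨M, C, hS, hC⟩ := hoff i
          have h1 := M.switchCost_triangle (D i b) (D i (!b))
          have h2 := hD i b
          exact ⟨M, C, hS, by omega⟩
      · push Not at hfull
        obtain ⟨e, he, heA⟩ := hfull
        exact ⟨b, P, e, he, heA, hP, hoff⟩
    have hcost := A.cost_concat_of_not_contains heA
    refine ⟨σ ++ [e], b', P', fun i => hits i + if (D i b').Contains e then 0 else 1,
      by omega, ?_, ?_, fun i => ?_⟩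
    · have : ∑ i, (if (D i b').Contains e then 0 else 1) ≤ 1 := by
        rw [show (∑ i, if (D i b').Contains e then 0 else 1) =
            (Finset.univ.filter fun i => ¬ (D i b').Contains e).card by
          rw [Finset.card_filter]
          exact Finset.sum_congr rfl fun i _ => by split_ifs <;> rfl]
        refine Finset.card_le_one.2 fun i hi j hj => ?_
        exact hmiss b' e heG i j (by simpa using hi) (by simpa using hj)
      rw [Finset.sum_add_distrib]
      omega
    · refine hP'.imp_right fun ⟨M, hM, h⟩ => ⟨M, hM, ?_⟩
      have := M.switchCost_triangle (A.state σ) (A.state (σ ++ [e]))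
      rw [cost_concat]
      omega
    · obtain ⟨M, C, hS, hC⟩ := hoff' i
      by_cases he : (D i b').Contains e
      · refine ⟨D i b', _, hS.concat he, ?_⟩
        simp only [Cache.switchCost_self, if_pos he]
        omega
      -- A miss costs `1` to serve and at most `2` to repair, hence the factor `3` of `hits`.
      · obtain ⟨M', hM', h1, h2⟩ := (D i b').exists_serve hk e
        refine ⟨M', _, hS.concat hM', ?_⟩
        have := M.switchCost_triangle (D i b') M'
        simp only [if_neg he]
        omega

end OnlineAlgorithm

/-! ### The two graphs and the offline caches. -/

/-- Two chains of `m` blocks each. Block `j` is a complete bipartite graph on the nodes `(j, s)`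
with `s < k`, without the edge between the two nodes `(j, 0)`. Consecutive blocks `j` and `j + 1`
are joined by a bridge, from the outgoing node `(j, 0)` to the ingoing node `(j + 1, 0)`. The
bridge that leaves the first chain goes to the second chain or to its end, depending on `b`. -/
def Link (m : ℕ) (b : Bool) (j s j' t : ℕ) : Prop :=
  (j = j' ∧ j < 2 * m ∧ (s ≠ 0 ∨ t ≠ 0)) ∨
  (s = 0 ∧ t = 0 ∧ ((j = j' + 1 ∧ j' < 2 * m ∧ (j' + 1 = m → b = false)) ∨
    (j = 2 * m ∧ j' + 1 = m ∧ b = true)))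

/-- The node `(j, s)` has the number `j * k + s`. -/
def graph (n k m : ℕ) (b : Bool) : Set (Edge n) :=
  {e | Link m b (e.1 / k) (e.1 % k) (e.2 / k) (e.2 % k)}

/-- The colour of the bridge that enters block `j`, when the bridge that leaves block `i` is
missing. -/
def blockColour (i j : ℕ) : ℕ := if j ≤ i then 0 else 1

/-- The matching with index `c` of a colouring of all edges but the bridge that leaves block `i`. -/
def Coloured (k m i : ℕ) (b : Bool) (c j s j' t : ℕ) : Prop :=
  (j = j' ∧ j < 2 * m ∧ (s ≠ 0 ∨ t ≠ 0) ∧ (s + t + blockColour i j) % k = c) ∨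
  (s = 0 ∧ t = 0 ∧
    ((j = j' + 1 ∧ j' < 2 * m ∧ j' ≠ i ∧ (j' + 1 = m → b = false) ∧ c = blockColour i j') ∨
    (j = 2 * m ∧ j' + 1 = m ∧ b = true ∧ c = 0)))

theorem eq_of_add_mod_eq {a t t' : ℕ} (ht : t < k) (ht' : t' < k)
    (h : (t + a) % k = (t' + a) % k) : t = t' := by
  have := Nat.ModEq.add_right_cancel' a h
  rwa [Nat.ModEq, Nat.mod_eq_of_lt ht, Nat.mod_eq_of_lt ht'] at this

theorem eq_zero_of_add_mod_eq {a t : ℕ} (ht : t < k) (ha : a < k)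
    (h : (t + a) % k = a) : t = 0 :=
  eq_of_add_mod_eq (a := a) ht (by omega) (by rw [h, zero_add, Nat.mod_eq_of_lt ha])

theorem blockColour_lt (hk : 2 ≤ k) (i j : ℕ) : blockColour i j < k := by
  unfold blockColour; split_ifs <;> omega

theorem blockColour_succ {i j : ℕ} (h : j ≠ i) : blockColour i (j + 1) = blockColour i j := by
  unfold blockColour; split_ifs <;> omega

/-- Inside a block the colouring is a cyclic Latin square shifted so that the absent edge would get
the colour of the block; this colour is free for the bridges at `(j, 0)`. At the common end `(2 * m,
0)`, the bridge from the first chain has colour `0`, and the one from the second has colour `1` or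
is the omitted one, by `i < 2 * m`. -/
theorem Coloured.right_unique {m i c j s j₁ t₁ j₂ t₂ : ℕ} {b : Bool} (hk : 2 ≤ k)
    (hi' : i < 2 * m) (ht₁ : t₁ < k) (ht₂ : t₂ < k)
    (h₁ : Coloured k m i b c j s j₁ t₁) (h₂ : Coloured k m i b c j s j₂ t₂) :
    j₁ = j₂ ∧ t₁ = t₂ := by
  have key : ∀ {j₁ t₁ j₂ t₂ : ℕ}, t₁ < k → j = j₁ → s ≠ 0 ∨ t₁ ≠ 0 →
      (s + t₁ + blockColour i j) % k = c → s = 0 → j = j₂ + 1 → j₂ ≠ i →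
      c = blockColour i j₂ → False := by
    intro j₁ t₁ j₂ t₂ ht hj hst hc hs hj2 hne hc2
    subst hs
    rw [hj2, blockColour_succ hne, hc2, zero_add] at hc
    have := eq_zero_of_add_mod_eq ht (blockColour_lt hk _ _) hc
    omega
  have last : ∀ {j₁ : ℕ}, j = j₁ + 1 → j₁ ≠ i → j = 2 * m → c = blockColour i j₁ → c = 0 →
      False := by
    intro j₁ h1 h2 h3 h4 h5
    rw [blockColour, if_neg (by omega)] at h4
    omega
  rcases h₁ with ⟨a1, a2, a3, a4⟩ | ⟨a1, a2, ⟨a3, a4, a5, a6, a7⟩ | ⟨a3, a4, a5, a6⟩⟩ <;>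
    rcases h₂ with ⟨b1, b2, b3, b4⟩ | ⟨b1, b2, ⟨b3, b4, b5, b6, b7⟩ | ⟨b3, b4, b5, b6⟩⟩
  · refine ⟨by omega, eq_of_add_mod_eq (a := s + blockColour i j) ht₁ ht₂ ?_⟩
    rw [show t₁ + (s + blockColour i j) = s + t₁ + blockColour i j by ring,
      show t₂ + (s + blockColour i j) = s + t₂ + blockColour i j by ring, a4, b4]
  · exact (key (t₂ := 0) ht₁ a1 a3 a4 b1 b3 b5 b7).elim
  · omega
  · exact (key (t₂ := 0) ht₂ b1 b3 b4 a1 a3 a5 a7).elim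
  · omega
  · exact (last a3 a5 b3 a7 b6).elim
  · omega
  · exact (last b3 b5 a3 b7 a6).elim
  · omega

/-- The same argument at the other side. Here `m ≤ i` is needed: it gives block `m - 1` colour `0`,
the colour of its redirected bridge. -/
theorem Coloured.left_unique {m i c j t j₁ s₁ j₂ s₂ : ℕ} {b : Bool} (hk : 2 ≤ k)
    (hi : m ≤ i) (hs₁ : s₁ < k) (hs₂ : s₂ < k)
    (h₁ : Coloured k m i b c j₁ s₁ j t) (h₂ : Coloured k m i b c j₂ s₂ j t) :
    j₁ = j₂ ∧ s₁ = s₂ := by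
  have key : ∀ {s : ℕ}, s < k → s ≠ 0 ∨ t ≠ 0 → (s + t + blockColour i j) % k = c → t = 0 →
      c = blockColour i j → False := by
    intro s hs hst hc ht hc2
    subst ht
    rw [hc2, add_zero] at hc
    have := eq_zero_of_add_mod_eq hs (blockColour_lt hk _ _) hc
    omega
  have first : j + 1 = m → c = 0 → c = blockColour i j := by
    intro h1 h2
    rw [blockColour, if_pos (by omega), h2]
  rcases h₁ with ⟨rfl, a2, a3, a4⟩ | ⟨a1, a2, ⟨a3, a4, a5, a6, a7⟩ | ⟨a3, a4, a5, a6⟩⟩ <;>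
    rcases h₂ with ⟨b1, b2, b3, b4⟩ | ⟨b1, b2, ⟨b3, b4, b5, b6, b7⟩ | ⟨b3, b4, b5, b6⟩⟩
  · subst b1
    refine ⟨rfl, eq_of_add_mod_eq (a := t + blockColour i j₂) hs₁ hs₂ ?_⟩
    rw [← add_assoc, ← add_assoc, a4, b4]
  · exact (key hs₁ a3 a4 b2 b7).elim
  · exact (key hs₁ a3 a4 b2 (first b4 b6)).elim
  · subst b1
    exact (key hs₂ b3 b4 a2 a7).elim
  · omega
  · simp_all
  · subst b1
    exact (key hs₂ b3 b4 a2 (first a4 a6)).elim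
  · simp_all
  · omega

theorem node_eq {u v : Fin n} (h : u.val / k = v.val / k ∧ u.val % k = v.val % k) : u = v := by
  rw [Fin.ext_iff, ← Nat.div_add_mod u.val k, ← Nat.div_add_mod v.val k, h.1, h.2]

open Classical in
/-- The cache that holds all edges of `graph n k m b` but the bridge that leaves block `i`. -/
noncomputable def chainCache (n : ℕ) {k m i : ℕ} (hk : 2 ≤ k) (hi : m ≤ i)
    (hi' : i < 2 * m) (b : Bool) : Cache n k where
  matching c := Finset.univ.filter fun e =>
    Coloured k m i b c (e.1 / k) (e.1 % k) (e.2 / k) (e.2 % k)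
  isMatching := by
    intro c e he f hf hef
    simp only [Finset.mem_filter, Finset.mem_univ, true_and] at he hf
    have hmod : ∀ x : ℕ, x % k < k := fun x => Nat.mod_lt _ (by omega)
    rcases hef with h | h
    · rw [h] at he
      exact Prod.ext h (node_eq (he.right_unique hk hi' (hmod _) (hmod _) hf))
    · rw [h] at he
      exact Prod.ext (node_eq (he.left_unique hk hi (hmod _) (hmod _) hf)) h

section chainCache

variable {m i : ℕ} {hk : 2 ≤ k} {hi : m ≤ i} {hi' : i < 2 * m} {b : Bool}

theorem mem_chainCache {c : Fin k} {e : Edge n} :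
    e ∈ (chainCache n hk hi hi' b).matching c ↔
      Coloured k m i b c (e.1 / k) (e.1 % k) (e.2 / k) (e.2 % k) := by
  simp [chainCache]

theorem div_eq_of_not_contains_chainCache {e : Edge n} (he : e ∈ graph n k m b)
    (h : ¬ (chainCache n hk hi hi' b).Contains e) : e.2.val / k = i := by
  by_contra hne
  refine h ?_
  rcases he with ⟨h1, h2, h3⟩ | ⟨h1, h2, ⟨h3, h4, h5⟩ | ⟨h3, h4, h5⟩⟩
  · exact ⟨⟨_, Nat.mod_lt _ (by omega)⟩, mem_chainCache.2 (Or.inl ⟨h1, h2, h3, rfl⟩)⟩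
  · exact ⟨⟨_, blockColour_lt hk i (e.2 / k)⟩,
      mem_chainCache.2 (Or.inr ⟨h1, h2, Or.inl ⟨h3, h4, hne, h5, rfl⟩⟩)⟩
  · exact ⟨⟨0, by omega⟩, mem_chainCache.2 (Or.inr ⟨h1, h2, Or.inr ⟨h3, h4, h5, rfl⟩⟩)⟩

/-- Since `m ≤ i`, the bridge leaving block `m - 1` has colour `0` for either value of `b`, so
redirecting it is the only insertion. -/
theorem switchCost_chainCache_not :
    (chainCache n hk hi hi' b).switchCost (chainCache n hk hi hi' (!b)) ≤ 1 := by
  have hnew : ∀ c j s j' t, Coloured k m i (!b) c j s j' t → ¬ Coloured k m i b c j s j' t →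
      c = 0 ∧ s = 0 ∧ t = 0 ∧ j' + 1 = m ∧ j = if b then m else 2 * m := by
    intro c j s j' t h h'
    rcases h with h | ⟨h1, h2, ⟨h3, h4, h5, h6, h7⟩ | ⟨h3, h4, h5, h6⟩⟩
    · exact (h' (Or.inl h)).elim
    · by_cases hj : j' + 1 = m
      · have hb := h6 hj
        rw [blockColour, if_pos (by omega)] at h7
        simp only [Bool.not_eq_false'] at hb
        exact ⟨h7, h1, h2, hj, by rw [if_pos hb]; omega⟩
      · exact (h' (Or.inr ⟨h1, h2, Or.inl ⟨h3, h4, h5, fun h => absurd h hj, h7⟩⟩)).elim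
    · simp only [Bool.not_eq_true'] at h5
      exact ⟨h6, h1, h2, h4, by simp [h5, h3]⟩
  let j₀ : Fin k := ⟨0, by omega⟩
  refine (Cache.switchCost_le j₀ _ (Finset.Subset.refl _) fun c hc e he => ?_).trans
    (Finset.card_le_one.2 fun e he f hf => ?_)
  · by_contra h
    rw [mem_chainCache] at he h
    exact hc (Fin.ext (hnew _ _ _ _ _ he h).1)
  · rw [Finset.mem_sdiff, mem_chainCache, mem_chainCache] at he hf
    obtain ⟨-, h1, h2, h3, h4⟩ := hnew _ _ _ _ _ he.1 he.2
    obtain ⟨-, h1', h2', h3', h4'⟩ := hnew _ _ _ _ _ hf.1 hf.2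
    exact Prod.ext (node_eq ⟨h4.trans h4'.symm, h1.trans h1'.symm⟩)
      (node_eq ⟨by omega, h2.trans h2'.symm⟩)

end chainCache

/-! ### Saturated blocks force equal colours. -/

section saturation

variable {M : Cache n k} {u : Fin n} {nb : Fin k → Fin n}

/-- A matching holds at most one edge at `u`, so `k` distinct edges at `u` fill all `k` matchings,
each edge lying in exactly one. -/
theorem Cache.exists_matching_of_injective (hnb : Function.Injective nb)
    (h : ∀ t, M.Contains (u, nb t)) : ∃ σ : Equiv.Perm (Fin k), ∀ t c,
      (u, nb t) ∈ M.matching c ↔ σ t = c := by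
  choose φ hφ using h
  have hinj : Function.Injective φ := by
    intro t t' htt
    have h1 := hφ t'
    rw [← htt] at h1
    exact hnb (Prod.ext_iff.1 (M.isMatching _ _ (hφ t) _ h1 (Or.inl rfl))).2
  refine ⟨Equiv.ofBijective φ (Finite.injective_iff_bijective.1 hinj), fun t c => ?_⟩
  refine ⟨fun h => ?_, fun h => h ▸ hφ t⟩
  obtain ⟨t', rfl⟩ := (Finite.injective_iff_bijective.1 hinj).2 c
  have := hnb (Prod.ext_iff.1 (M.isMatching _ _ h _ (hφ t') (Or.inl rfl))).2
  rw [this]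
  rfl

/-- If the `k` ingoing nodes of a block are saturated, then the bridge that leaves it and the
bridge that enters it are in the same matching. -/
theorem Cache.mem_matching_of_block {p q : Fin k → Fin n} {x y : Fin n} (t₀ : Fin k)
    (hp : Function.Injective p) (hq : Function.Injective q) (hx : ∀ s, x ≠ p s)
    (hy : ∀ t, y ≠ q t) (hM : ∀ s t, (s ≠ t₀ ∨ t ≠ t₀) → M.Contains (p s, q t))
    (hin : M.Contains (p t₀, y)) {c : Fin k} (hout : (x, q t₀) ∈ M.matching c) :
    (p t₀, y) ∈ M.matching c ∧ ∀ d, (p t₀, y) ∈ M.matching d → d = c := by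
  have hinj : Function.Injective (Function.update q t₀ y) := by
    intro a a' haa
    by_cases ha : a = t₀ <;> by_cases ha' : a' = t₀
    · rw [ha, ha']
    · subst ha
      rw [Function.update_self, Function.update_of_ne ha'] at haa
      exact absurd haa (hy _)
    · subst ha'
      rw [Function.update_self, Function.update_of_ne ha] at haa
      exact absurd haa.symm (hy _)
    · rw [Function.update_of_ne ha, Function.update_of_ne ha'] at haa
      exact hq haa
  have hcon : ∀ t, M.Contains (p t₀, Function.update q t₀ y t) := by
    intro t
    by_cases ht : t = t₀
    · subst ht; simpa using hin
    · rw [Function.update_of_ne ht]; exact hM _ _ (Or.inr ht)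
  obtain ⟨τ, hτ⟩ := Cache.exists_matching_of_injective hinj hcon
  have huniq : ∀ d, (p t₀, y) ∈ M.matching d ↔ τ t₀ = d := by
    intro d
    simpa using hτ t₀ d
  have hmem : (p t₀, y) ∈ M.matching c := by
    -- Otherwise matching `c` would match all `k` nodes `p s` into the `k` nodes `q t`, leaving no
    -- room for the edge from `x` to `q t₀`.
    by_contra hno
    have hpartner : ∀ s, ∃ t, (p s, q t) ∈ M.matching c := by
      intro s
      by_cases hs : s = t₀
      · subst hs
        have hne : τ.symm c ≠ s := by
          rintro rfl
          exact hno ((huniq c).2 (by simp))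
        have := (hτ (τ.symm c) c).2 (by simp)
        rw [Function.update_of_ne hne] at this
        exact ⟨_, this⟩
      · obtain ⟨ρ, hρ⟩ := Cache.exists_matching_of_injective hq (fun t => hM s t (Or.inl hs))
        exact ⟨ρ.symm c, (hρ _ c).2 (by simp)⟩
    choose f hf using hpartner
    have hfinj : Function.Injective f := by
      intro s s' hss
      have h1 := hf s'
      rw [← hss] at h1
      exact hp (Prod.ext_iff.1 (M.isMatching _ _ (hf s) _ h1 (Or.inr rfl))).1
    obtain ⟨s, hs⟩ := (Finite.injective_iff_bijective.1 hfinj).2 t₀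
    have h1 := hf s
    rw [hs] at h1
    exact hx s (Prod.ext_iff.1 (M.isMatching _ _ hout _ h1 (Or.inr rfl))).1
  exact ⟨hmem, fun d hd => ((huniq d).1 hd).symm.trans ((huniq c).1 hmem)⟩

end saturation

/-! ### Rigidity of the chains. -/

/-- The node `(j, s)`. -/
def node (n k j s : ℕ) [NeZero n] : Fin n := Fin.ofNat n (j * k + s)

section rigidity

variable [NeZero n] {m : ℕ} {b : Bool} {M : Cache n k}

/-- All numbers in use are at most `2 * m * k < n`, so `Fin.ofNat` does not wrap around. -/
theorem val_node {j s : ℕ} (hn : 2 * m * k + 1 ≤ n) (hs : s < k)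
    (hj : j < 2 * m ∨ j = 2 * m ∧ s = 0) : (node n k j s).val = j * k + s := by
  refine Nat.mod_eq_of_lt ?_
  rcases hj with hj | ⟨rfl, rfl⟩
  · have := Nat.mul_le_mul_right k hj
    rw [Nat.succ_mul] at this
    omega
  · omega

theorem div_node {j s : ℕ} (hn : 2 * m * k + 1 ≤ n) (hs : s < k)
    (hj : j < 2 * m ∨ j = 2 * m ∧ s = 0) : (node n k j s).val / k = j := by
  rw [val_node hn hs hj, mul_comm, Nat.mul_add_div (by omega), Nat.div_eq_of_lt hs, add_zero]

theorem mod_node {j s : ℕ} (hn : 2 * m * k + 1 ≤ n) (hs : s < k)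
    (hj : j < 2 * m ∨ j = 2 * m ∧ s = 0) : (node n k j s).val % k = s := by
  rw [val_node hn hs hj, mul_comm, Nat.mul_add_mod, Nat.mod_eq_of_lt hs]

theorem node_inj {j s j' s' : ℕ} (hn : 2 * m * k + 1 ≤ n) (hs : s < k) (hs' : s' < k)
    (hj : j < 2 * m ∨ j = 2 * m ∧ s = 0) (hj' : j' < 2 * m ∨ j' = 2 * m ∧ s' = 0)
    (h : node n k j s = node n k j' s') : j = j' ∧ s = s' := by
  constructor
  · rw [← div_node hn hs hj, h, div_node hn hs' hj']
  · rw [← mod_node hn hs hj, h, mod_node hn hs' hj']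

theorem mem_graph_node {j s j' t : ℕ} (hn : 2 * m * k + 1 ≤ n) (hs : s < k) (ht : t < k)
    (h : Link m b j s j' t) : (node n k j s, node n k j' t) ∈ graph n k m b := by
  have h1 : j < 2 * m ∨ j = 2 * m ∧ s = 0 := by unfold Link at h; omega
  have h2 : j' < 2 * m ∨ j' = 2 * m ∧ t = 0 := by unfold Link at h; omega
  change Link m b _ _ _ _
  rwa [div_node hn hs h1, mod_node hn hs h1, div_node hn ht h2, mod_node hn ht h2]

/-- The bridge from block `j` to block `j'`. -/
abbrev bridge (n k j j' : ℕ) [NeZero n] : Edge n := (node n k j' 0, node n k j 0)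

theorem mem_matching_bridge_step (hn : 2 * m * k + 1 ≤ n) (hk : 0 < k)
    (hM : ∀ e ∈ graph n k m b, M.Contains e) {j x : ℕ} (hj : j + 1 < 2 * m)
    (hb : j + 1 = m → b = false) (hx : x ≤ 2 * m) (hxj : x ≠ j + 1) {c : Fin k}
    (hout : bridge n k (j + 1) x ∈ M.matching c) :
    bridge n k j (j + 1) ∈ M.matching c ∧
      ∀ d, bridge n k j (j + 1) ∈ M.matching d → d = c := by
  refine Cache.mem_matching_of_block (M := M) (t₀ := ⟨0, hk⟩)
    (p := fun s => node n k (j + 1) s) (q := fun t => node n k (j + 1) t) (x := node n k x 0)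
    (y := node n k j 0) ?_ ?_ ?_ ?_ ?_ ?_ hout
  · intro s s' h
    exact Fin.ext (node_inj hn s.2 s'.2 (Or.inl hj) (Or.inl hj) h).2
  · intro s s' h
    exact Fin.ext (node_inj hn s.2 s'.2 (Or.inl hj) (Or.inl hj) h).2
  · intro s h
    have := (node_inj hn hk s.2 (by omega) (Or.inl hj) h).1
    omega
  · intro s h
    have := (node_inj hn hk s.2 (by omega) (Or.inl hj) h).1
    omega
  · intro s t hst
    refine hM _ (mem_graph_node hn s.2 t.2 (Or.inl ⟨rfl, hj, ?_⟩))
    simpa [Fin.ext_iff] using hst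
  · exact hM _ (mem_graph_node hn hk hk (Or.inr ⟨rfl, rfl, Or.inl ⟨rfl, by omega, hb⟩⟩))

/-- The colour of a bridge determines the colours of all bridges before it, as far as the chain
is not interrupted. -/
theorem mem_matching_bridge (hn : 2 * m * k + 1 ≤ n) (hk : 0 < k)
    (hM : ∀ e ∈ graph n k m b, M.Contains e) {l r x : ℕ} (hr : r < 2 * m)
    (hb : ∀ j, l ≤ j → j < r → j + 1 = m → b = false) (hx : x ≤ 2 * m) (hxr : r < x) {c : Fin k}
    (hout : bridge n k r x ∈ M.matching c) (j : ℕ) (hlj : l ≤ j) (hjr : j < r) :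
    bridge n k j (j + 1) ∈ M.matching c ∧
      ∀ d, bridge n k j (j + 1) ∈ M.matching d → d = c := by
  induction r generalizing x with
  | zero => omega
  | succ r ih =>
    have hstep := mem_matching_bridge_step hn hk hM hr (hb r (by omega) (by omega)) hx
      (by omega) hout
    rcases Nat.lt_succ_iff_lt_or_eq.1 hjr with h | rfl
    · exact ih (by omega) (fun j h1 h2 => hb j h1 (by omega)) (by omega) (by omega) hstep.1 h
    · exact hstep

theorem exists_colour_of_forall_contains (hn : 2 * m * k + 1 ≤ n) (hk : 0 < k) (hm : 0 < m)
    (hM : ∀ e ∈ graph n k m false, M.Contains e) :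
    ∃ c, ∀ j, j + 1 < 2 * m → bridge n k j (j + 1) ∈ M.matching c ∧
      ∀ d, bridge n k j (j + 1) ∈ M.matching d → d = c := by
  obtain ⟨c, hc⟩ := hM (bridge n k (2 * m - 1) (2 * m)) (mem_graph_node hn hk hk
    (Or.inr ⟨rfl, rfl, Or.inl ⟨by omega, by omega, fun _ => rfl⟩⟩))
  exact ⟨c, fun j hj => mem_matching_bridge (l := 0) hn hk hM (by omega) (fun _ _ _ _ => rfl)
    le_rfl (by omega) hc j (Nat.zero_le _) (by omega)⟩

/-- The last bridges of both chains meet at `(2 * m, 0)`, so they lie in different matchings; each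
colour then propagates back through its own chain. -/
theorem exists_two_colours_of_forall_contains (hn : 2 * m * k + 1 ≤ n) (hk : 0 < k) (hm : 0 < m)
    (hM : ∀ e ∈ graph n k m true, M.Contains e) :
    ∃ c c', c ≠ c' ∧
      (∀ j, j + 1 < m → bridge n k j (j + 1) ∈ M.matching c ∧
        ∀ d, bridge n k j (j + 1) ∈ M.matching d → d = c) ∧
      ∀ j, m ≤ j → j + 1 < 2 * m → bridge n k j (j + 1) ∈ M.matching c' ∧
        ∀ d, bridge n k j (j + 1) ∈ M.matching d → d = c' := by
  obtain ⟨c', hc'⟩ := hM (bridge n k (2 * m - 1) (2 * m)) (mem_graph_node hn hk hk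
    (Or.inr ⟨rfl, rfl, Or.inl ⟨by omega, by omega, fun _ => by omega⟩⟩))
  obtain ⟨c, hc⟩ := hM (bridge n k (m - 1) (2 * m)) (mem_graph_node hn hk hk
    (Or.inr ⟨rfl, rfl, Or.inr ⟨by omega, by omega, rfl⟩⟩))
  refine ⟨c, c', ?_, fun j hj => ?_, fun j hmj hj => ?_⟩
  · rintro rfl
    have := (Prod.ext_iff.1 (M.isMatching _ _ hc _ hc' (Or.inl rfl))).2
    have := (node_inj hn hk hk (by omega) (by omega) this).1
    omega
  · exact mem_matching_bridge (l := 0) hn hk hM (by omega) (fun _ _ _ _ => by omega)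
      le_rfl (by omega) hc j (Nat.zero_le _) (by omega)
  · exact mem_matching_bridge (l := m) hn hk hM (by omega) (fun _ _ _ _ => by omega)
      le_rfl (by omega) hc' j hmj (by omega)

theorem card_bridges (hn : 2 * m * k + 1 ≤ n) (hk : 0 < k) (l : ℕ) (hl : l ≤ m) :
    ((Finset.range (m - 1)).image fun j => bridge n k (l + j) (l + j + 1)).card = m - 1 := by
  rw [Finset.card_image_of_injOn, Finset.card_range]
  intro j hj j' hj' h
  simp only [Finset.coe_range, Set.mem_Iio] at hj hj'
  have := (node_inj hn hk hk (by omega) (by omega) (Prod.ext_iff.1 h).2).1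
  omega

/-- An edge may be cached in several matchings at once; the uniqueness in `h` ensures that no bridge
has a copy in `c'` beforehand. -/
theorem le_switchCost_of_bridges {M' : Cache n k} (hn : 2 * m * k + 1 ≤ n) (hk : 0 < k) (l : ℕ)
    (hl : l ≤ m) {c c' : Fin k} (hcc : c ≠ c')
    (h : ∀ j, l ≤ j → j + 1 < l + m → ∀ d, bridge n k j (j + 1) ∈ M.matching d → d = c)
    (h' : ∀ j, l ≤ j → j + 1 < l + m → bridge n k j (j + 1) ∈ M'.matching c') :
    m - 1 ≤ M.switchCost M' := by
  rw [← card_bridges hn hk l hl]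
  refine Cache.card_le_switchCost (j := c') ?_ ?_
  · intro e he
    obtain ⟨j, hj, rfl⟩ := Finset.mem_image.1 he
    rw [Finset.mem_range] at hj
    exact h' _ (by omega) (by omega)
  · intro e he hmem
    obtain ⟨j, hj, rfl⟩ := Finset.mem_image.1 he
    rw [Finset.mem_range] at hj
    exact hcc (h _ (by omega) (by omega) _ hmem).symm

/-- To pass from a cache that holds one of the two graphs to a cache that holds the other one, all
bridges of one of the two chains have to be moved to another matching. -/
theorem le_switchCost_of_forall_contains (hn : 2 * m * k + 1 ≤ n) (hk : 0 < k) (hm : 0 < m)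
    {M' : Cache n k} (hM : ∀ e ∈ graph n k m b, M.Contains e)
    (hM' : ∀ e ∈ graph n k m (!b), M'.Contains e) : m - 1 ≤ M.switchCost M' := by
  cases b with
  | false =>
    obtain ⟨a, ha⟩ := exists_colour_of_forall_contains hn hk hm hM
    obtain ⟨c, c', hcc, hc, hc'⟩ := exists_two_colours_of_forall_contains hn hk hm hM'
    -- As `c ≠ c'`, the single colour `a` differs from the colour of at least one chain.
    by_cases hac : a = c
    · exact le_switchCost_of_bridges hn hk m le_rfl (hac ▸ hcc)
        (fun j h1 h2 => (ha j (by omega)).2) (fun j h1 h2 => (hc' j (by omega) (by omega)).1)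
    · exact le_switchCost_of_bridges hn hk 0 (Nat.zero_le _) hac
        (fun j h1 h2 => (ha j (by omega)).2) (fun j h1 h2 => (hc j (by omega)).1)
  | true =>
    obtain ⟨a, ha⟩ := exists_colour_of_forall_contains hn hk hm hM'
    obtain ⟨c, c', hcc, hc, hc'⟩ := exists_two_colours_of_forall_contains hn hk hm hM
    by_cases hac : a = c
    · exact le_switchCost_of_bridges hn hk m le_rfl (hac ▸ hcc.symm)
        (fun j h1 h2 => (hc' j (by omega) (by omega)).2) (fun j h1 h2 => (ha j (by omega)).1)
    · exact le_switchCost_of_bridges hn hk 0 (Nat.zero_le _) (Ne.symm hac)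
        (fun j h1 h2 => (hc j (by omega)).2) (fun j h1 h2 => (ha j (by omega)).1)

end rigidity

/-! ### Conclusion. -/

theorem OnlineAlgorithm.IsCompetitive.le_mul_of_chains {A : OnlineAlgorithm n k} {c : ℝ}
    (hc : A.IsCompetitive c) {m : ℕ} (hn : 2 * m * k + 1 ≤ n) (hk : 2 ≤ k) (hm : 2 ≤ m) :
    (m : ℝ) ≤ 5 * c := by
  have : NeZero n := ⟨by omega⟩
  let D : Fin m → Bool → Cache n k := fun i b =>
    chainCache n hk (Nat.le_add_right m i) (by omega : m + i < 2 * m) b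
  let K : ℕ := ∑ i, (Cache.empty n k).switchCost (D i false)
  have hm1 : ((m - 1 : ℕ) : ℝ) = m - 1 := by push_cast [Nat.cast_sub (by omega : 1 ≤ m)]; ring
  have hm2 : (2 : ℝ) ≤ m := by exact_mod_cast hm
  have hm0 : (0 : ℝ) < m := by linarith
  have key := hc.one_le_mul (q := 5 / m) (K := (K + m) / m) fun T => by
    obtain ⟨σ, hσ, h⟩ := A.exists_adversary (by omega) (graph n k m) D (w := m - 1) (by omega)
      (fun b M M' h h' => le_switchCost_of_forall_contains hn (by omega) (by omega) h h')
      (fun i b => switchCost_chainCache_not)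
      (fun b e he i j h h' => by
        have h1 := div_eq_of_not_contains_chainCache he h
        have h2 := div_eq_of_not_contains_chainCache he h'
        exact Fin.ext (by omega)) T
    refine ⟨σ, hσ, ?_⟩
    rw [Fintype.card_fin] at h
    -- This is `m ≤ 2 * (m - 1)`, that is, `2 ≤ m`; it is the source of the constant `5`.
    have h2 : m + 3 * (m - 1) ≤ 5 * (m - 1) := by omega
    have h3 : (m - 1) * (m * optCost k σ) ≤ (m - 1) * (K + m + 5 * A.cost σ) := by
      have := Nat.mul_le_mul_right (A.cost σ) h2
      calc _ ≤ _ := h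
        _ ≤ (m - 1) * K + m * (m - 1) + 5 * (m - 1) * A.cost σ := by gcongr
        _ = _ := by ring
    have h4 := Nat.le_of_mul_le_mul_left h3 (by omega)
    have h5 : (m : ℝ) * optCost k σ ≤ K + m + 5 * A.cost σ := by exact_mod_cast h4
    rw [div_mul_eq_mul_div, ← add_div, le_div_iff₀ hm0]
    linarith
  rw [← mul_div_assoc, le_div_iff₀ hm0] at key
  linarith

end CachingInMatchings

theorem mainTheorem2 :
    ∃ α : ℝ, 0 < α ∧ ∀ n k : ℕ, 2 ≤ k → k < n →
      ∀ (A : CachingInMatchings.OnlineAlgorithm n k) (c : ℝ),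
        A.IsCompetitive c → α * ((n : ℝ) / (k : ℝ)) ≤ c := by
  -- From `n / k ≤ 2 * (m + 1)`: if `2 ≤ m`, this is at most `3 * m ≤ 15 * c`; if `m ≤ 1`, it is at
  -- most `4 ≤ 15 * c`.
  refine ⟨1 / 15, by norm_num, fun n k hk hkn A c hc => ?_⟩
  have hc1 := hc.one_le hkn
  -- The largest `m` for which `2 * m` blocks of `k` nodes and the end node fit into `n` nodes.
  obtain ⟨m, hm⟩ : ∃ m, m = (n - 1) / (2 * k) := ⟨_, rfl⟩
  have hle : 2 * m * k + 1 ≤ n := by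
    have := Nat.div_mul_le_self (n - 1) (2 * k)
    rw [← hm] at this
    have h2 : 2 * m * k = m * (2 * k) := by ring
    omega
  have hge : n ≤ 2 * (m + 1) * k := by
    have := Nat.lt_mul_div_succ (n - 1) (b := 2 * k) (by omega)
    rw [← hm] at this
    have h2 : 2 * (m + 1) * k = 2 * k * (m + 1) := by ring
    omega
  have hk0 : (0 : ℝ) < k := by exact_mod_cast (by omega : 0 < k)
  have hnk : (n : ℝ) / k ≤ 2 * (m + 1) := by
    rw [div_le_iff₀ hk0]
    exact_mod_cast hge
  rcases le_or_gt 2 m with h | h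
  · have h1 := hc.le_mul_of_chains hle hk h
    have h2 : (2 : ℝ) ≤ m := by exact_mod_cast h
    linarith
  · have h2 : (m : ℝ) ≤ 1 := by exact_mod_cast (by omega : m ≤ 1)
    linarith
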